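/- **Setting.** Let $N$ be a matroid on a finite ground set, whose elements are called points. Call two circuits of $N$ of size at most $\operatorname{rank}(N)$ equivalent if they have the same closure. The equivalence classes are called the *subspaces* of $N$. A point $p$ belongs to a subspace $l$ (written $p\in l$) if $p$ lies in some circuit of the class $l$, and $\operatorname{rank}(l)$ is the rank of any circuit in $l$. Let $\mathcal L_p(N)$ be the set of subspaces of $N$ that contain $p$, put $$a_p(N)=\sum_{l\in\mathcal L_p(N)}\operatorname{rank}(l)-\operatorname{rank}(N)\,\bigl(|\mathcal L_p(N)|-1\bigr)\in\mathbb Z ,$$ and let $P_N$ be the set of points $p$ of $N$ with $a_p(N)\le 0$. Let $M$ be a matroid on a finite ground set $E$, of rank $n$. Its *solvable chain* is $M^0=M$, $M^{j+1}=P_{M^j}$ for $j\ge 0$, where each subset of $E$ is regarded as a submatroid (restriction) of $M$. The matroid $M$ is *solvable* if $M^j=\emptyset$ for some $j$. Let $\Gamma_M\subset(\mathbb C^n)^E$ be the set of realizations of $M$, that is, of the families $\gamma=(\gamma_e)_{e\in E}$ of vectors in $\mathbb C^n$ such that, for every $I\subset E$, the family $(\gamma_e)_{e\in I}$ is linearly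 independent if and only if $I$ is independent in $M$. The *matroid variety* $V_M$ is the Zariski closure of $\Gamma_M$ in $(\mathbb C^n)^E$. For a set $S$ of points let $\gamma_S$ be the linear span of $\{\gamma_q: q\in S\}$; in particular $\gamma_l$ is the span of the $\gamma_q$ with $q\in l$. A realization $\gamma\in\Gamma_M$ is *stable* if for every $j\ge 0$ and every point $p\in M^j\setminus M^{j+1}$, $$\dim\bigcap_{l\in\mathcal L_p(M^j)}\gamma_l=a_p(M^j),$$ where the intersection is taken inside $\gamma_{M^j}$ (so that it equals $\gamma_{M^j}$ when $\mathcal L_p(M^j)=\emptyset$). Let $\Gamma_M^0\subset\Gamma_M$ be the set of stable realizations. **Theorem.** Let $M$ be a solvable matroid with $\Gamma_M^0\neq\emptyset$. Then the Zariski closure $\overline{\Gamma_M^0}$ is an irreducible component of $V_M$. -/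

import Mathlib

namespace SolvableMatroid

variable {E : Type*}

/-! ### Subspaces of a matroid, expected dimensions, solvable matroids -/

/-- The rank `rk_N(X)` of a set `X` in the matroid `N`, as a natural number. All matroids below live
on a finite type, so the extended rank is finite and nothing is lost. -/
noncomputable def rk (N : Matroid E) (X : Set E) : ℕ := (N.eRk X).toNat

/-- The rank of the matroid `N`. -/
noncomputable def rank (N : Matroid E) : ℕ := rk N N.E

/-- The circuits of `N` of size less than `rank N + 1`. -/
def smallCircuits (N : Matroid E) : Set (Set E) :=
  {C | N.IsCircuit C ∧ C.ncard < rank N + 1}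

/-- The set `𝓛_N` of subspaces of `N`: the equivalence classes of the circuits of size less than
`rank N + 1` under `C₁ ∼ C₂ ↔ closure C₁ = closure C₂`. -/
def subspaces (N : Matroid E) : Set (Set (Set E)) :=
  {l | ∃ C ∈ smallCircuits N, l = {C' | C' ∈ smallCircuits N ∧ N.closure C' = N.closure C}}

/-- The points of a subspace `l`: those that lie in some circuit of the class `l`. -/
def points (l : Set (Set E)) : Set E := {p | ∃ C ∈ l, p ∈ C}

/-- The rank of a subspace `l`; it is the rank of any circuit in `l`, see `subspaceRank_eq`. -/
noncomputable def subspaceRank (N : Matroid E) (l : Set (Set E)) : ℕ := rk N (points l)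

theorem subspaceRank_eq (N : Matroid E) {l : Set (Set E)} (hl : l ∈ subspaces N) {C : Set E}
    (hC : C ∈ l) : subspaceRank N l = rk N C := by
  obtain ⟨C₀, -, rfl⟩ := hl
  have h1 : C ⊆ points {C' | C' ∈ smallCircuits N ∧ N.closure C' = N.closure C₀} :=
    fun p hp => ⟨C, hC, hp⟩
  have h2 : points {C' | C' ∈ smallCircuits N ∧ N.closure C' = N.closure C₀} ⊆ N.closure C := by
    rintro p ⟨C', hC', hp⟩
    rw [hC.2, ← hC'.2]
    exact N.subset_closure C' hC'.1.1.subset_ground hp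
  unfold subspaceRank rk
  congr 1
  refine le_antisymm ?_ (N.eRk_mono h1)
  calc _ ≤ N.eRk (N.closure C) := N.eRk_mono h2
    _ = _ := N.eRk_closure_eq C

/-- The set `𝓛_p` of the subspaces of `N` that contain the point `p`. -/
def subspacesThrough (N : Matroid E) (p : E) : Set (Set (Set E)) :=
  {l | l ∈ subspaces N ∧ p ∈ points l}

/-- The expected dimension
`a_p = (∑_{l ∈ 𝓛_p} rank l) - rank N * (|𝓛_p| - 1)`, an integer. -/
noncomputable def expectedDim (N : Matroid E) (p : E) : ℤ :=
  (∑ᶠ l ∈ subspacesThrough N p, (subspaceRank N l : ℤ)) -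
    (rank N : ℤ) * (((subspacesThrough N p).ncard : ℤ) - 1)

/-- The set `P_N` of the points `p` of `N` with `a_p ≤ 0`. -/
def nonpositivePoints (N : Matroid E) : Set E := {p | p ∈ N.E ∧ expectedDim N p ≤ 0}

/-- The solvable chain: `M⁰ = M`, and `Mʲ⁺¹` is the submatroid of `Mʲ` on the point set `P_{Mʲ}`. -/
noncomputable def solvableChain (M : Matroid E) : ℕ → Matroid E
  | 0 => M
  | j + 1 => (solvableChain M j).restrict (nonpositivePoints (solvableChain M j))

/-- `M` is solvable if its solvable chain reaches the empty matroid. -/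
def IsSolvable (M : Matroid E) : Prop := ∃ j, (solvableChain M j).E = ∅

/-! ### Collections of vectors with the Zariski topology -/

/-- The affine space `(ℂᵈ)ᴱ` of collections of vectors in `ℂᵈ` indexed by `E`. -/
def Collections (E : Type*) (d : ℕ) : Type _ := E → Fin d → ℂ

/-- The zero set in `(ℂᵈ)ᴱ` of an ideal of polynomials in the coordinates `x_{e,i}`. -/
def zeroSet {d : ℕ} (I : Ideal (MvPolynomial (E × Fin d) ℂ)) : Set (Collections E d) :=
  {γ | (fun x : E × Fin d => γ x.1 x.2) ∈ MvPolynomial.zeroLocus ℂ I}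

theorem mem_zeroSet {d : ℕ} (I : Ideal (MvPolynomial (E × Fin d) ℂ)) (γ : Collections E d) :
    γ ∈ zeroSet I ↔ ∀ p ∈ I, MvPolynomial.aeval (fun x : E × Fin d => γ x.1 x.2) p = 0 :=
  Iff.rfl

theorem mem_zeroSet_sSup {d : ℕ} (S : Set (Ideal (MvPolynomial (E × Fin d) ℂ)))
    (γ : Collections E d) : γ ∈ zeroSet (sSup S) ↔ ∀ I ∈ S, γ ∈ zeroSet I := by
  have h' : ∀ I : Ideal (MvPolynomial (E × Fin d) ℂ), γ ∈ zeroSet I ↔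
      I ≤ RingHom.ker (MvPolynomial.aeval (R := ℂ) (fun x : E × Fin d => γ x.1 x.2)) :=
    fun I => Iff.rfl
  rw [h', sSup_le_iff]
  exact Iff.rfl

theorem mem_zeroSet_mul {d : ℕ} (I J : Ideal (MvPolynomial (E × Fin d) ℂ))
    (γ : Collections E d) : γ ∈ zeroSet (I * J) ↔ γ ∈ zeroSet I ∨ γ ∈ zeroSet J := by
  constructor
  · intro h
    by_contra! hcon
    simp only [mem_zeroSet, not_forall] at hcon
    obtain ⟨⟨p, hp, hp'⟩, q, hq, hq'⟩ := hcon
    have h2 := (mem_zeroSet _ _).1 h (p * q) (Ideal.mul_mem_mul hp hq)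
    rw [map_mul] at h2
    exact (mul_ne_zero hp' hq') h2
  · intro h
    rw [mem_zeroSet]
    intro p hp
    have hp2 : p ∈ I ⊓ J := Ideal.mul_le_inf hp
    rcases h with h | h
    · exact (mem_zeroSet _ _).1 h p hp2.1
    · exact (mem_zeroSet _ _).1 h p hp2.2

/-- The Zariski topology on `(ℂᵈ)ᴱ`: the closed sets are the zero sets of ideals. -/
instance zariskiTopology (E : Type*) (d : ℕ) : TopologicalSpace (Collections E d) :=
  TopologicalSpace.ofClosed {Z | ∃ I, Z = zeroSet I}
    ⟨⊤, by
      refine (Set.eq_empty_of_forall_notMem fun γ hγ => ?_).symm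
      have h := (mem_zeroSet _ _).1 hγ 1 Submodule.mem_top
      rw [map_one] at h
      exact one_ne_zero h⟩
    (by
      intro A hA
      refine ⟨sSup {I | zeroSet I ∈ A}, ?_⟩
      ext γ
      rw [mem_zeroSet_sSup, Set.mem_sInter]
      constructor
      · exact fun h I hI => h _ hI
      · intro h Z hZ
        obtain ⟨I, rfl⟩ := hA hZ
        exact h I hZ)
    (by
      rintro _ ⟨I, rfl⟩ _ ⟨J, rfl⟩
      refine ⟨I * J, ?_⟩
      ext γ
      rw [mem_zeroSet_mul, Set.mem_union])

/-! ### Realizations and stable realizations -/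

/-- The space `Γ_M` of realizations of `M` in `ℂⁿ`, `n = rank M`: the collections of vectors
whose (indexed) linearly independent subfamilies are exactly the independent sets of `M`. -/
def realizationSpace (M : Matroid E) : Set (Collections E (rank M)) :=
  {γ | ∀ I ⊆ M.E, M.Indep I ↔ LinearIndepOn ℂ γ I}

/-- The matroid variety `V_M`, the Zariski closure of `Γ_M`. -/
def matroidVariety (M : Matroid E) : Set (Collections E (rank M)) := closure (realizationSpace M)

/-- The span `γ_S` of the vectors `γ_q`, `q ∈ S`. -/
def spanOf {d : ℕ} (γ : Collections E d) (S : Set E) : Submodule ℂ (Fin d → ℂ) :=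
  Submodule.span ℂ {v | ∃ q ∈ S, v = γ q}

/-- `V_{γ,p} = ⋂_{l ∈ 𝓛_p} γ_l` for the restriction of `γ` to a submatroid `N`. The intersection is
taken inside the span of the vectors `γ_q`, `q ∈ N`, which contains every `γ_l` and is the
realization space `ℂ^{rank N}` of `N` up to a linear isomorphism; this matters only when `𝓛_p` is
empty, where the intersection is that whole span. -/
def intersectionAt {d : ℕ} (N : Matroid E) (γ : Collections E d) (p : E) :
    Submodule ℂ (Fin d → ℂ) :=
  spanOf γ N.E ⊓ ⨅ l ∈ subspacesThrough N p, spanOf γ (points l)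

/-- The restriction of `γ` to `N` is quasi-stable: at every point `p ∉ P_N` of `N`, the space
`V_{γ,p}` has the expected dimension `a_p`. -/
def IsQuasiStable {d : ℕ} (N : Matroid E) (γ : Collections E d) : Prop :=
  ∀ p ∈ N.E, p ∉ nonpositivePoints N →
    (Module.finrank ℂ (intersectionAt N γ p) : ℤ) = expectedDim N p

/-- The set `Γ_M⁰` of stable realizations: the realizations of `M` whose restriction to every member
of the solvable chain is quasi-stable. (Empty members of the chain impose no condition.) -/
def stableRealizations (M : Matroid E) : Set (Collections E (rank M)) :=
  {γ | γ ∈ realizationSpace M ∧ ∀ j, IsQuasiStable (solvableChain M j) γ}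

end SolvableMatroid

/-!
The stable realizations `Γ_M⁰` form a nonempty subset of the matroid variety `V_M` that is open and
irreducible; the closure of such a set is an irreducible component.

Openness. A point of `V_M` satisfies all dependencies of `M`, so it is a realization as soon as the
independent sets of `M` have independent vectors, which is an open condition. On realizations, the
spaces `γ_l` have constant dimension, so the dimension of an intersection of them is at least the
expected one by counting codimensions (`sum_finrank_le_finrank_inf_iInf`). It is also upper
semicontinuous, being the dimension of the kernel of a matrix with polynomial entries
(`exists_kernel_section`). Stability therefore only bounds dimensions from above.

Irreducibility. By descending induction along the solvable chain, the collections whose restrictions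
to `Mʲ, Mʲ⁺¹, …` are quasi-stable realizations form an irreducible set; vectors at points outside
`Mʲ` are left arbitrary, so that all these sets lie in the same affine space. At the end of the
chain the set is the whole affine space. To pass from `Mʲ⁺¹` to `Mʲ` (`isPreirreducible_step`), the
space of `Mʲ` and, inside it, the space of every subspace `l` of `Mʲ` are chosen first, through
spanning vectors that are free subject to containing the vectors already there. The vector at a new
point `p` is then an arbitrary element of the intersection of the spaces of the `l ∋ p`, whose
dimension is the constant `a_p > 0`. Every dependency of `Mʲ` is enforced in this way, since a
circuit either lies in a subspace or has more elements than the rank (`realizes_of_mem`); the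
independences are an open condition.

Both choices are vectors in a family of linear spaces of constant dimension over an irreducible
base. The total space of such a family is irreducible by `isPreirreducible_biUnion_of_sections`:
local polynomial sections, obtained from adjugate matrices in `exists_kernel_section`, move any two
points into a common fibre, where a line joins them.
-/

namespace SolvableMatroid

open MvPolynomial

section Zariski

variable {I J : Type*} {d d' : ℕ}

/-! ### Polynomial maps and lines in the Zariski topology -/

/-- Evaluation of polynomials in the coordinates `x_{e,i}` at a collection of vectors. -/
noncomputable def evalAt (γ : Collections I d) : MvPolynomial (I × Fin d) ℂ →ₐ[ℂ] ℂ :=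
  aeval fun x : I × Fin d => γ x.1 x.2

@[simp] lemma evalAt_X (γ : Collections I d) (x : I × Fin d) : evalAt γ (X x) = γ x.1 x.2 := by
  simp [evalAt]

@[simp] lemma evalAt_C (γ : Collections I d) (c : ℂ) : evalAt γ (C c) = c := by
  simp [evalAt]

lemma isOpen_evalAt_ne_zero (p : MvPolynomial (I × Fin d) ℂ) :
    IsOpen {γ : Collections I d | evalAt γ p ≠ 0} := by
  refine ⟨Ideal.span {p}, ?_⟩
  ext γ
  rw [Set.mem_compl_iff, Set.mem_ofPred_eq, not_not, mem_zeroSet]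
  constructor
  · intro h q hq
    obtain ⟨r, rfl⟩ := Ideal.mem_span_singleton.1 hq
    change evalAt γ (p * r) = 0
    rw [map_mul, h, zero_mul]
  · exact fun h => h p (Ideal.mem_span_singleton_self p)

/-- The sets where a polynomial does not vanish form a basis of the Zariski topology. -/
lemma isOpen_iff_evalAt {U : Set (Collections I d)} :
    IsOpen U ↔ ∀ γ ∈ U, ∃ p, evalAt γ p ≠ 0 ∧ ∀ γ', evalAt γ' p ≠ 0 → γ' ∈ U := by
  constructor
  · rintro ⟨K, hK⟩ γ hγ
    have h : γ ∉ zeroSet K := by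
      rw [← hK]
      exact fun h => h hγ
    rw [mem_zeroSet] at h
    push Not at h
    obtain ⟨p, hp, hγp⟩ := h
    refine ⟨p, hγp, fun γ' hγ' => ?_⟩
    by_contra hU
    have h' : γ' ∈ zeroSet K := by
      rw [← hK]
      exact hU
    exact hγ' (h' p hp)
  · intro h
    refine isOpen_iff_forall_mem_open.2 fun γ hγ => ?_
    obtain ⟨p, hp, hpU⟩ := h γ hγ
    exact ⟨_, hpU, isOpen_evalAt_ne_zero p, hp⟩

/-- Polynomial maps are continuous in the Zariski topology. -/
lemma continuous_of_polynomial {s : Collections I d → Collections J d'}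
    (p : J → Fin d' → MvPolynomial (I × Fin d) ℂ) (h : ∀ γ e i, s γ e i = evalAt γ (p e i)) :
    Continuous s := by
  have key : ∀ γ q, evalAt (s γ) q = evalAt γ (bind₁ (fun x : J × Fin d' => p x.1 x.2) q) := by
    intro γ q
    simp only [evalAt, aeval_bind₁]
    congr 2
    funext x
    exact h γ x.1 x.2
  refine continuous_def.2 fun U hU => isOpen_iff_evalAt.2 fun γ hγ => ?_
  obtain ⟨q, hq, hqU⟩ := isOpen_iff_evalAt.1 hU _ hγ
  refine ⟨bind₁ (fun x : J × Fin d' => p x.1 x.2) q, ?_, fun γ' hγ' => hqU _ ?_⟩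
  · rwa [← key]
  · rwa [key]

/-- The point with parameter `t` on the affine line through `x` and `y`. -/
def linePoint (x y : Collections I d) (t : ℂ) : Collections I d :=
  fun e => (1 - t) • x e + t • y e

/-- Affine lines are irreducible: two open sets that meet a line meet in a point of the line. -/
lemma exists_linePoint_mem {U V : Set (Collections I d)} (hU : IsOpen U) (hV : IsOpen V)
    {x y : Collections I d} (hx : x ∈ U) (hy : y ∈ V) :
    ∃ t, linePoint x y t ∈ U ∩ V := by
  obtain ⟨f, hf, hfU⟩ := isOpen_iff_evalAt.1 hU x hx
  obtain ⟨g, hg, hgV⟩ := isOpen_iff_evalAt.1 hV y hy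
  let L : MvPolynomial (I × Fin d) ℂ →ₐ[ℂ] Polynomial ℂ := aeval fun a : I × Fin d =>
    (1 - Polynomial.X) * Polynomial.C (x a.1 a.2) + Polynomial.X * Polynomial.C (y a.1 a.2)
  have hL : ∀ t q, (L q).eval t = evalAt (linePoint x y t) q := by
    intro t q
    have : (Polynomial.aeval t : Polynomial ℂ →ₐ[ℂ] ℂ).comp L = evalAt (linePoint x y t) := by
      refine MvPolynomial.algHom_ext fun a => ?_
      simp only [L, linePoint, AlgHom.comp_apply, aeval_X, evalAt_X, Polynomial.coe_aeval_eq_eval,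
        Polynomial.eval_add, Polynomial.eval_mul, Polynomial.eval_sub, Polynomial.eval_one,
        Polynomial.eval_X, Polynomial.eval_C, Pi.add_apply, Pi.smul_apply, smul_eq_mul]
    rw [← this, AlgHom.comp_apply, Polynomial.coe_aeval_eq_eval]
  have h0 : linePoint x y 0 = x := by funext e; simp [linePoint]
  have h1 : linePoint x y 1 = y := by funext e; simp [linePoint]
  have hne : L f * L g ≠ 0 := by
    refine mul_ne_zero (fun h => hf ?_) (fun h => hg ?_)
    · rw [← h0, ← hL, h, Polynomial.eval_zero]
    · rw [← h1, ← hL, h, Polynomial.eval_zero]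
  by_contra! hcon
  refine hne (Polynomial.funext fun t => ?_)
  rw [Polynomial.eval_mul, Polynomial.eval_zero, hL, hL]
  by_contra h
  exact hcon t ⟨hfU _ (left_ne_zero_of_mul h), hgV _ (right_ne_zero_of_mul h)⟩

lemma isPreirreducible_univ_collections :
    IsPreirreducible (Set.univ : Set (Collections I d)) := by
  rintro U V hU hV ⟨x, -, hx⟩ ⟨y, -, hy⟩
  obtain ⟨t, ht⟩ := exists_linePoint_mem hU hV hx hy
  exact ⟨_, Set.mem_univ _, ht⟩

lemma _root_.IsPreirreducible.inter_isOpen {X : Type*} [TopologicalSpace X] {S O : Set X}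
    (hS : IsPreirreducible S) (hO : IsOpen O) : IsPreirreducible (S ∩ O) := by
  rintro U V hU hV ⟨x, ⟨hxS, hxO⟩, hxU⟩ ⟨y, ⟨hyS, hyO⟩, hyV⟩
  obtain ⟨z, hzS, ⟨hzU, hzO⟩, hzV, -⟩ := hS (U ∩ O) (V ∩ O) (hU.inter hO) (hV.inter hO)
    ⟨x, hxS, hxU, hxO⟩ ⟨y, hyS, hyV, hyO⟩
  exact ⟨z, ⟨hzS, hzO⟩, hzU, hzV⟩

/-- A family of affine subspaces over an irreducible base, with local continuous sections through
every point, sweeps out an irreducible set: sections move any two points into a common fibre, where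
they are joined by a line. -/
lemma isPreirreducible_biUnion_of_sections {Y : Set (Collections I d)} (hY : IsPreirreducible Y)
    (F : Collections I d → Set (Collections J d'))
    (hF : ∀ y, ∀ x ∈ F y, ∀ x' ∈ F y, ∀ t, linePoint x x' t ∈ F y)
    (hs : ∀ y ∈ Y, ∀ x ∈ F y, ∃ s : Collections I d → Collections J d', Continuous s ∧ s y = x ∧
      ∃ O, IsOpen O ∧ y ∈ O ∧ ∀ y' ∈ Y ∩ O, s y' ∈ F y') :
    IsPreirreducible (⋃ y ∈ Y, F y) := by
  rintro U V hU hV ⟨x, hx, hxU⟩ ⟨x', hx', hxV⟩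
  simp only [Set.mem_iUnion] at hx hx'
  obtain ⟨y, hy, hxy⟩ := hx
  obtain ⟨y', hy', hxy'⟩ := hx'
  obtain ⟨s, hsc, rfl, O, hO, hyO, hsO⟩ := hs y hy x hxy
  obtain ⟨s', hsc', rfl, O', hO', hyO', hsO'⟩ := hs y' hy' x' hxy'
  obtain ⟨w, hwY, ⟨hwO, hwU⟩, hwO', hwV⟩ := hY (O ∩ s ⁻¹' U) (O' ∩ s' ⁻¹' V)
    (hO.inter (hU.preimage hsc)) (hO'.inter (hV.preimage hsc')) ⟨y, hy, hyO, hxU⟩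
    ⟨y', hy', hyO', hxV⟩
  obtain ⟨t, ht⟩ := exists_linePoint_mem hU hV hwU hwV
  refine ⟨linePoint (s w) (s' w) t, ?_, ht⟩
  simp only [Set.mem_iUnion]
  exact ⟨w, hwY, hF w _ (hsO w ⟨hwY, hwO⟩) _ (hsO' w ⟨hwY, hwO'⟩) t⟩

end Zariski

section Kernels

variable {I : Type*} {d : ℕ}

/-! ### Kernels of matrices with polynomial entries -/

/-- Every matrix over a field has a reflexive generalized inverse. -/
lemma exists_generalizedInverse {K κ ι : Type*} [Field K] [Fintype κ] [Fintype ι] [DecidableEq κ]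
    [DecidableEq ι] (A : Matrix κ ι K) :
    ∃ P : Matrix ι κ K, A * P * A = A ∧ P * A * P = P := by
  obtain ⟨g, hg⟩ := A.toLin'.rangeRestrict.exists_rightInverse_of_surjective
    A.toLin'.range_rangeRestrict
  obtain ⟨f, hf⟩ := g.exists_extend
  have h : A * LinearMap.toMatrix' f * A = A := by
    apply Matrix.toLin'.injective
    rw [Matrix.toLin'_mul, Matrix.toLin'_mul, Matrix.toLin'_toMatrix']
    refine LinearMap.ext fun v => ?_
    have h1 := LinearMap.congr_fun hg (A.toLin'.rangeRestrict v)
    have h2 := LinearMap.congr_fun hf (A.toLin'.rangeRestrict v)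
    simp only [LinearMap.comp_apply, LinearMap.id_apply, Submodule.coe_subtype] at h1 h2 ⊢
    have h3 := congrArg Subtype.val h1
    rw [← h2] at h3
    exact h3
  generalize LinearMap.toMatrix' f = P at h
  refine ⟨P * A * P, ?_, ?_⟩
  · calc A * (P * A * P) * A = (A * P * A) * P * A := by simp only [Matrix.mul_assoc]
      _ = A := by rw [h, h]
  · calc P * A * P * A * (P * A * P) = P * (A * P * A) * P * A * P := by
          simp only [Matrix.mul_assoc]
      _ = P * A * P * A * P := by rw [h]
      _ = P * (A * P * A) * P := by simp only [Matrix.mul_assoc]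
      _ = P * A * P := by rw [h]

/-- Kernels of a matrix with polynomial entries `A`. If `P` is a reflexive generalized inverse of
the value `A₀` of `A` at `γ₀`, then `B = 1 + P (A - A₀)` has the value `1` at `γ₀`. Where
`det B ≠ 0`, it embeds `ker (P A)`, which contains `ker A`, into `ker A₀`, and `adj B` carries
`ker A₀` back into `ker (P A)`. -/
lemma exists_kernel_section {κ ι : Type*} [Fintype κ] [Fintype ι] [DecidableEq κ] [DecidableEq ι]
    (A : Matrix κ ι (MvPolynomial (I × Fin d) ℂ)) (γ₀ : Collections I d) :
    ∃ O, IsOpen O ∧ γ₀ ∈ O ∧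
      (∀ γ ∈ O, Module.finrank ℂ (LinearMap.ker (A.map (evalAt γ)).toLin') ≤
        Module.finrank ℂ (LinearMap.ker (A.map (evalAt γ₀)).toLin')) ∧
      ∀ v ∈ LinearMap.ker (A.map (evalAt γ₀)).toLin',
        ∃ p : ι → MvPolynomial (I × Fin d) ℂ, (∀ i, evalAt γ₀ (p i) = v i) ∧
          ∀ γ ∈ O, Module.finrank ℂ (LinearMap.ker (A.map (evalAt γ₀)).toLin') ≤
              Module.finrank ℂ (LinearMap.ker (A.map (evalAt γ)).toLin') →
            (fun i => evalAt γ (p i)) ∈ LinearMap.ker (A.map (evalAt γ)).toLin' := by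
  set A₀ := A.map (evalAt γ₀) with hA₀
  obtain ⟨P, hP1, hP2⟩ := exists_generalizedInverse A₀
  let c : ℂ →+* MvPolynomial (I × Fin d) ℂ := C
  have hc : ∀ γ z, evalAt γ (c z) = z := evalAt_C
  let B : Matrix ι ι (MvPolynomial (I × Fin d) ℂ) := 1 + P.map c * (A - A₀.map c)
  have hB : ∀ γ, B.map (evalAt γ) = 1 + P * (A.map (evalAt γ) - A₀) := by
    intro γ
    have h1 : (P.map c).map (evalAt γ) = P := by
      ext i j
      simp [hc]
    have h2 : (A - A₀.map c).map (evalAt γ) = A.map (evalAt γ) - A₀ := by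
      ext i j
      simp [hc]
    rw [Matrix.map_add _ (map_add _), Matrix.map_one _ (map_zero _) (map_one _), Matrix.map_mul,
      h1, h2]
  have hB₀ : B.map (evalAt γ₀) = 1 := by rw [hB, ← hA₀, sub_self, Matrix.mul_zero, add_zero]
  have hdet : ∀ γ, evalAt γ B.det = (B.map (evalAt γ)).det := fun γ => AlgHom.map_det _ _
  have hkerle : ∀ γ, LinearMap.ker (A.map (evalAt γ)).toLin' ≤
      LinearMap.ker (P * A.map (evalAt γ)).toLin' := by
    intro γ v hv
    rw [LinearMap.mem_ker, Matrix.toLin'_apply] at hv ⊢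
    rw [← Matrix.mulVec_mulVec, hv, Matrix.mulVec_zero]
  have hfin : ∀ γ, evalAt γ B.det ≠ 0 →
      Module.finrank ℂ (LinearMap.ker (P * A.map (evalAt γ)).toLin') ≤
        Module.finrank ℂ (LinearMap.ker A₀.toLin') := by
    intro γ hγ
    have hinj : Function.Injective (B.map (evalAt γ)).toLin' := by
      rw [hdet] at hγ
      exact Matrix.mulVec_injective_of_det_ne_zero hγ
    rw [(Submodule.equivMapOfInjective _ hinj _).finrank_eq]
    refine Submodule.finrank_mono ?_
    rintro _ ⟨v, hv, rfl⟩
    rw [SetLike.mem_coe, LinearMap.mem_ker, Matrix.toLin'_apply] at hv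
    rw [LinearMap.mem_ker, Matrix.toLin'_apply, Matrix.toLin'_apply, hB, Matrix.add_mulVec,
      Matrix.mul_sub, Matrix.sub_mulVec, hv, zero_sub, Matrix.one_mulVec, Matrix.mulVec_add,
      Matrix.mulVec_neg, Matrix.mulVec_mulVec, ← Matrix.mul_assoc, hP1, add_neg_cancel]
  refine ⟨{γ | evalAt γ B.det ≠ 0}, isOpen_evalAt_ne_zero _, ?_, fun γ hγ => ?_, fun v hv => ?_⟩
  · rw [Set.mem_ofPred_eq, hdet, hB₀, Matrix.det_one]
    exact one_ne_zero
  · exact (Submodule.finrank_mono (hkerle γ)).trans (hfin γ hγ)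
  · have hs : ∀ γ, (fun i => evalAt γ ((B.adjugate.mulVec fun j => C (v j)) i)) =
        (B.map (evalAt γ)).adjugate.mulVec v := by
      intro γ
      have h1 := (evalAt γ).map_adjugate B
      rw [AlgHom.mapMatrix_apply, AlgHom.mapMatrix_apply] at h1
      rw [← h1]
      funext i
      simp [Matrix.mulVec, dotProduct]
    refine ⟨B.adjugate.mulVec fun j => C (v j), fun i => ?_, fun γ hγ hle => ?_⟩
    · rw [congrFun (hs γ₀) i, hB₀, Matrix.adjugate_one, Matrix.one_mulVec]
    · have heq := Submodule.eq_of_le_of_finrank_le (hkerle γ) ((hfin γ hγ).trans hle)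
      rw [heq, hs γ, LinearMap.mem_ker, Matrix.toLin'_apply, ← Matrix.mulVec_mulVec]
      set s := (B.map (evalAt γ)).adjugate.mulVec v
      set w := (A.map (evalAt γ)).mulVec s with hw
      rw [LinearMap.mem_ker, Matrix.toLin'_apply] at hv
      have h1 : (B.map (evalAt γ)).mulVec s = (B.map (evalAt γ)).det • v := by
        rw [Matrix.mulVec_mulVec, Matrix.mul_adjugate, Matrix.smul_mulVec, Matrix.one_mulVec]
      have h2 : A₀.mulVec (P.mulVec w) = 0 := by
        have hA : A₀.mulVec (P.mulVec (A₀.mulVec s)) = A₀.mulVec s := by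
          simp only [Matrix.mulVec_mulVec, ← Matrix.mul_assoc, hP1]
        have h3 := congrArg A₀.mulVec h1
        rw [Matrix.mulVec_smul, hv, smul_zero, hB, Matrix.add_mulVec, Matrix.one_mulVec,
          ← Matrix.mulVec_mulVec, Matrix.sub_mulVec, ← hw, Matrix.mulVec_sub, Matrix.mulVec_add,
          Matrix.mulVec_sub, hA, add_sub_cancel] at h3
        exact h3
      rw [← hP2, ← Matrix.mulVec_mulVec, ← Matrix.mulVec_mulVec, h2, Matrix.mulVec_zero]

lemma isOpen_finrank_ker_le {κ ι : Type*} [Fintype κ] [Fintype ι] [DecidableEq κ] [DecidableEq ι]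
    (A : Matrix κ ι (MvPolynomial (I × Fin d) ℂ)) (k : ℕ) :
    IsOpen {γ : Collections I d |
      Module.finrank ℂ (LinearMap.ker (A.map (evalAt γ)).toLin') ≤ k} := by
  refine isOpen_iff_forall_mem_open.2 fun γ hγ => ?_
  obtain ⟨O, hO, hγO, h, -⟩ := exists_kernel_section A γ
  exact ⟨O, fun γ' hγ' => (h γ' hγ').trans hγ, hO, hγO⟩

/-! ### Intersections of spans of independent families -/

lemma spanOf_eq_span_range (γ : Collections I d) (S : Set I) :
    spanOf γ S = Submodule.span ℂ (Set.range fun e : S => γ e) := by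
  unfold spanOf
  congr 1
  ext v
  constructor
  · rintro ⟨q, hq, rfl⟩
    exact ⟨⟨q, hq⟩, rfl⟩
  · rintro ⟨q, rfl⟩
    exact ⟨q, q.2, rfl⟩

lemma mem_spanOf_iff (γ : Collections I d) (S : Set I) [Fintype S] (v : Fin d → ℂ) :
    v ∈ spanOf γ S ↔ ∃ c : S → ℂ, ∑ e, c e • γ e = v := by
  rw [spanOf_eq_span_range, Submodule.mem_span_range_iff_exists_fun]

lemma isOpen_linearIndepOn [Finite I] (S : Set I) :
    IsOpen {γ : Collections I d | LinearIndepOn ℂ γ S} := by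
  classical
  have := Fintype.ofFinite S
  let A : Matrix (Fin d) S (MvPolynomial (I × Fin d) ℂ) := Matrix.of fun i e => X (e.1, i)
  convert! isOpen_finrank_ker_le A 0 using 2
  ext γ
  rw [Nat.le_zero, Submodule.finrank_eq_zero, LinearMap.ker_eq_bot']
  refine Fintype.linearIndependent_iff.trans ?_
  have h : ∀ c, (A.map (evalAt γ)).toLin' c = ∑ e : S, c e • γ e := by
    intro c
    funext i
    simp [A, Matrix.mulVec, dotProduct, mul_comm]
  simp only [h, funext_iff, Pi.zero_apply]

/-- The linear system whose solutions `(u, c)` are a vector `u` with its expansions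
`u = ∑ e ∈ S k, c k e • γ e`, one for each `k`. -/
noncomputable def expansionMatrix {K : Type*} [DecidableEq K] (d : ℕ) (S : K → Set I) :
    Matrix (K × Fin d) (Fin d ⊕ Σ k, S k) (MvPolynomial (I × Fin d) ℂ) :=
  Matrix.of fun a => Sum.elim (fun i => if a.2 = i then 1 else 0)
    fun b => if a.1 = b.1 then -X (b.2.1, a.2) else 0

lemma mem_ker_expansionMatrix {K : Type*} [DecidableEq I] [Fintype K] [DecidableEq K]
    (S : K → Set I) [∀ k, Fintype (S k)] (γ : Collections I d) (x : Fin d ⊕ (Σ k, S k) → ℂ) :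
    x ∈ LinearMap.ker ((expansionMatrix d S).map (evalAt γ)).toLin' ↔
      ∀ k, ∑ e : S k, x (Sum.inr ⟨k, e⟩) • γ e = fun i => x (Sum.inl i) := by
  have h : ∀ k i, ((expansionMatrix d S).map (evalAt γ)).toLin' x (k, i) =
      x (Sum.inl i) - (∑ e : S k, x (Sum.inr ⟨k, e⟩) • γ e) i := by
    intro k i
    rw [Matrix.toLin'_apply, Matrix.mulVec, dotProduct, Fintype.sum_sum_type, Fintype.sum_sigma,
      sub_eq_add_neg]
    congr 1
    · simp [expansionMatrix, apply_ite (evalAt γ)]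
    · rw [Finset.sum_eq_single k]
      · simp [expansionMatrix, mul_comm]
      · intro k' _ hk'
        simp [expansionMatrix, hk'.symm]
      · simp
  rw [LinearMap.mem_ker]
  constructor
  · intro hx k
    funext i
    have := congrFun hx (k, i)
    rw [h, Pi.zero_apply, sub_eq_zero] at this
    exact this.symm
  · intro hx
    funext ⟨k, i⟩
    rw [h, hx k, sub_self, Pi.zero_apply]

lemma map_ker_expansionMatrix {K : Type*} [DecidableEq I] [Fintype K] [DecidableEq K]
    (S : K → Set I) [∀ k, Fintype (S k)] (γ : Collections I d) :
    (LinearMap.ker ((expansionMatrix d S).map (evalAt γ)).toLin').map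
      (LinearMap.funLeft ℂ ℂ Sum.inl) = ⨅ k, spanOf γ (S k) := by
  ext u
  rw [Submodule.mem_map, Submodule.mem_iInf]
  constructor
  · rintro ⟨x, hx, rfl⟩ k
    rw [mem_ker_expansionMatrix] at hx
    exact (mem_spanOf_iff γ (S k) _).2 ⟨_, hx k⟩
  · intro hu
    choose c hc using fun k => (mem_spanOf_iff γ (S k) u).1 (hu k)
    exact ⟨Sum.elim u fun b => c b.1 b.2, (mem_ker_expansionMatrix S γ _).2 fun k => hc k, rfl⟩

lemma finrank_ker_expansionMatrix {K : Type*} [DecidableEq I] [Fintype K] [DecidableEq K]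
    (S : K → Set I) [∀ k, Fintype (S k)] (γ : Collections I d)
    (hS : ∀ k, LinearIndepOn ℂ γ (S k)) :
    Module.finrank ℂ (LinearMap.ker ((expansionMatrix d S).map (evalAt γ)).toLin') =
      Module.finrank ℂ (⨅ k, spanOf γ (S k) : Submodule ℂ (Fin d → ℂ)) := by
  rw [← map_ker_expansionMatrix]
  set W := LinearMap.ker ((expansionMatrix d S).map (evalAt γ)).toLin'
  have hinj : Function.Injective
      (((LinearMap.funLeft ℂ ℂ Sum.inl).comp W.subtype) : W →ₗ[ℂ] (Fin d → ℂ)) := by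
    rw [injective_iff_map_eq_zero]
    rintro ⟨x, hx⟩ h0
    have h0' : ∀ i, x (Sum.inl i) = 0 := congrFun h0
    rw [mem_ker_expansionMatrix] at hx
    ext a
    rcases a with i | ⟨k, e⟩
    · exact h0' i
    · have hk := hx k
      simp only [h0'] at hk
      exact Fintype.linearIndependent_iff.1 (hS k) (fun e => x (Sum.inr ⟨k, e⟩)) hk e
  rw [← LinearMap.finrank_range_of_inj hinj, LinearMap.range_comp, Submodule.range_subtype]

/-- Upper semicontinuity of the dimension of an intersection of spans of independent families. -/
lemma isOpen_finrank_iInf_spanOf_le [Finite I] {K : Type*} [Finite K] (S : K → Set I) (a : ℕ) :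
    IsOpen {γ : Collections I d | (∀ k, LinearIndepOn ℂ γ (S k)) ∧
      Module.finrank ℂ (⨅ k, spanOf γ (S k) : Submodule ℂ (Fin d → ℂ)) ≤ a} := by
  classical
  have := Fintype.ofFinite K
  have := fun k => Fintype.ofFinite (S k)
  have h : IsOpen ((⋂ k, {γ : Collections I d | LinearIndepOn ℂ γ (S k)}) ∩
      {γ | Module.finrank ℂ
        (LinearMap.ker ((expansionMatrix d S).map (evalAt γ)).toLin') ≤ a}) :=
    (isOpen_iInter_of_finite fun k => isOpen_linearIndepOn (S k)).inter
      (isOpen_finrank_ker_le _ a)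
  convert! h using 1
  ext γ
  simp only [Set.mem_ofPred_eq, Set.mem_inter_iff, Set.mem_iInter]
  exact and_congr_right fun hS => by rw [finrank_ker_expansionMatrix S γ hS]

/-- Through every vector in an intersection of spans of independent families there is a polynomial
section of the intersection, defined near the given collection as long as the dimension of the
intersection does not drop. -/
lemma exists_section_iInf_spanOf [Finite I] {K : Type*} [Finite K] (S : K → Set I)
    (γ₀ : Collections I d) (h₀ : ∀ k, LinearIndepOn ℂ γ₀ (S k)) {v : Fin d → ℂ}
    (hv : v ∈ ⨅ k, spanOf γ₀ (S k)) :
    ∃ p : Fin d → MvPolynomial (I × Fin d) ℂ, (∀ i, evalAt γ₀ (p i) = v i) ∧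
      ∃ O, IsOpen O ∧ γ₀ ∈ O ∧ ∀ γ ∈ O, (∀ k, LinearIndepOn ℂ γ (S k)) →
        Module.finrank ℂ (⨅ k, spanOf γ₀ (S k) : Submodule ℂ (Fin d → ℂ)) ≤
          Module.finrank ℂ (⨅ k, spanOf γ (S k) : Submodule ℂ (Fin d → ℂ)) →
        (fun i => evalAt γ (p i)) ∈ ⨅ k, spanOf γ (S k) := by
  classical
  have := Fintype.ofFinite K
  have := fun k => Fintype.ofFinite (S k)
  obtain ⟨O, hO, hγO, -, h⟩ := exists_kernel_section (expansionMatrix d S) γ₀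
  rw [← map_ker_expansionMatrix] at hv
  obtain ⟨x, hx, rfl⟩ := hv
  obtain ⟨p, hp, hpO⟩ := h x hx
  refine ⟨fun i => p (Sum.inl i), fun i => hp _, O, hO, hγO, fun γ hγ hS hle => ?_⟩
  rw [← finrank_ker_expansionMatrix S γ hS, ← finrank_ker_expansionMatrix S γ₀ h₀] at hle
  rw [← map_ker_expansionMatrix]
  exact ⟨_, hpO γ hγ hle, rfl⟩

end Kernels

section Matroids

variable {E : Type*} {d : ℕ}

/-! ### Spans in a realization -/

/-- The collection `γ`, restricted to the points of `N`, is a realization of `N`. -/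
def Realizes (N : Matroid E) (γ : Collections E d) : Prop :=
  ∀ I ⊆ N.E, N.Indep I ↔ LinearIndepOn ℂ γ I

lemma mem_spanOf {γ : Collections E d} {S : Set E} {q : E} (hq : q ∈ S) : γ q ∈ spanOf γ S :=
  Submodule.subset_span ⟨q, hq, rfl⟩

lemma spanOf_le {γ : Collections E d} {S : Set E} {W : Submodule ℂ (Fin d → ℂ)} :
    spanOf γ S ≤ W ↔ ∀ q ∈ S, γ q ∈ W := by
  unfold spanOf
  rw [Submodule.span_le]
  constructor
  · exact fun h q hq => h ⟨q, hq, rfl⟩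
  · rintro h _ ⟨q, hq, rfl⟩
    exact h q hq

lemma spanOf_congr {γ γ' : Collections E d} {S : Set E} (h : ∀ q ∈ S, γ q = γ' q) :
    spanOf γ S = spanOf γ' S :=
  le_antisymm (spanOf_le.2 fun q hq => h q hq ▸ mem_spanOf hq)
    (spanOf_le.2 fun q hq => h q hq ▸ mem_spanOf hq)

lemma finrank_spanOf_of_linearIndepOn [Finite E] {γ : Collections E d} {B : Set E}
    (h : LinearIndepOn ℂ γ B) : Module.finrank ℂ (spanOf γ B) = B.ncard := by
  have := Fintype.ofFinite B
  rw [spanOf_eq_span_range, finrank_span_eq_card h, ← Nat.card_coe_set_eq, Nat.card_eq_fintype_card]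

lemma Realizes.spanOf_eq_of_isBasis {N : Matroid E} {γ : Collections E d} (h : Realizes N γ)
    {B X : Set E} (hB : N.IsBasis B X) : spanOf γ B = spanOf γ X := by
  refine le_antisymm (spanOf_le.2 fun q hq => mem_spanOf (hB.subset hq))
    (spanOf_le.2 fun q hq => ?_)
  by_cases hqB : q ∈ B
  · exact mem_spanOf hqB
  · have hBi : LinearIndepOn ℂ γ B := (h B hB.indep.subset_ground).1 hB.indep
    have hd : ¬ LinearIndepOn ℂ γ (insert q B) := by
      rw [← h _ (Set.insert_subset (hB.subset_ground hq) hB.indep.subset_ground)]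
      exact (hB.insert_dep ⟨hq, hqB⟩).not_indep
    by_contra hq'
    rw [spanOf_eq_span_range] at hq'
    refine hd ((linearIndepOn_insert hqB).2 ⟨hBi, ?_⟩)
    exact fun h' => hq' ((congrArg (γ q ∈ Submodule.span ℂ ·) (Set.image_eq_range _ B)).mp h')

lemma Realizes.restrict {N : Matroid E} {γ : Collections E d} (h : Realizes N γ) {R : Set E}
    (hR : R ⊆ N.E) : Realizes (N.restrict R) γ := by
  intro I hI
  rw [Matroid.restrict_indep_iff, ← h I (hI.trans hR)]
  exact and_iff_left hI

lemma rk_eq_ncard {N : Matroid E} {B X : Set E} (hB : N.IsBasis B X) : rk N X = B.ncard := by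
  rw [rk, ← hB.encard_eq_eRk, Set.ncard]

lemma Realizes.finrank_spanOf [Finite E] {N : Matroid E} {γ : Collections E d} (h : Realizes N γ)
    {X : Set E} (hX : X ⊆ N.E) : Module.finrank ℂ (spanOf γ X) = rk N X := by
  obtain ⟨B, hB⟩ := N.exists_isBasis X hX
  rw [← h.spanOf_eq_of_isBasis hB, rk_eq_ncard hB]
  exact finrank_spanOf_of_linearIndepOn ((h B hB.indep.subset_ground).1 hB.indep)

/-- Every set has a basis whose trace on `R` is a basis of the trace of the set. -/
lemma exists_isBasis_inter (N : Matroid E) (R : Set E) {X : Set E} (hX : X ⊆ N.E) :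
    ∃ B, N.IsBasis B X ∧ N.IsBasis (B ∩ R) (X ∩ R) := by
  obtain ⟨B₀, hB₀⟩ := N.exists_isBasis (X ∩ R) (Set.inter_subset_left.trans hX)
  obtain ⟨B, hB, hle⟩ := hB₀.indep.subset_isBasis_of_subset
    (hB₀.subset.trans Set.inter_subset_left) hX
  refine ⟨B, hB, ?_⟩
  have : B ∩ R = B₀ := (hB₀.eq_of_subset_indep (hB.indep.subset Set.inter_subset_left)
    (Set.subset_inter hle (hB₀.subset.trans Set.inter_subset_right))
    (Set.inter_subset_inter_left R hB.subset)).symm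
  rwa [this]

/-! ### Subspaces of a matroid and expected dimensions -/

lemma points_subset_ground {N : Matroid E} {l : Set (Set E)} (hl : l ∈ subspaces N) :
    points l ⊆ N.E := by
  obtain ⟨C₀, -, rfl⟩ := hl
  rintro p ⟨C, hC, hp⟩
  exact hC.1.1.subset_ground hp

lemma exists_subspace_of_smallCircuit {N : Matroid E} {C : Set E} (hC : C ∈ smallCircuits N) :
    ∃ l ∈ subspaces N, C ∈ l :=
  ⟨_, ⟨C, hC, rfl⟩, hC, rfl⟩

lemma rk_circuit_lt_ncard [Finite E] {N : Matroid E} {C : Set E} (hC : N.IsCircuit C) :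
    rk N C < C.ncard := by
  have h := hC.eRk_add_one_eq
  have hf : N.eRk C ≠ ⊤ := by
    intro h'
    rw [h', top_add] at h
    exact (Set.encard_ne_top_iff.2 C.toFinite) h.symm
  lift N.eRk C to ℕ using hf with r hr
  rw [rk, ← hr, Set.ncard, ← h]
  exact Nat.lt_succ_self r

/-- The codimension of an intersection is at most the sum of the codimensions. -/
lemma sum_finrank_le_finrank_inf_iInf {K V ι : Type*} [Field K] [AddCommGroup V] [Module K V]
    [FiniteDimensional K V] (U : Submodule K V) (L : ι → Submodule K V) (s : Finset ι)
    (hL : ∀ l ∈ s, L l ≤ U) :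
    (∑ l ∈ s, (Module.finrank K (L l) : ℤ)) - Module.finrank K U * ((s.card : ℤ) - 1) ≤
      Module.finrank K (U ⊓ ⨅ l ∈ s, L l : Submodule K V) := by
  classical
  induction s using Finset.induction_on with
  | empty =>
    have h : U ⊓ ⨅ l ∈ (∅ : Finset ι), L l = U := by simp
    rw [h]
    simp
  | insert a s ha ih =>
    have ih' := ih fun l hl => hL l (Finset.mem_insert_of_mem hl)
    set W := U ⊓ ⨅ l ∈ s, L l with hW
    have heq : U ⊓ ⨅ l ∈ insert a s, L l = L a ⊓ W := by
      rw [Finset.iInf_insert, hW, inf_left_comm]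
    have h1 := Submodule.finrank_sup_add_finrank_inf_eq (L a) W
    have h2 : Module.finrank K (L a ⊔ W : Submodule K V) ≤ Module.finrank K U :=
      Submodule.finrank_mono (sup_le (hL a (Finset.mem_insert_self a s)) inf_le_left)
    rw [heq, Finset.sum_insert ha, Finset.card_insert_of_notMem ha]
    push_cast
    zify at h1 h2
    linarith

/-- The expected dimension is a lower bound for the dimension of the intersection. -/
lemma expectedDim_le_finrank [Finite E] (N : Matroid E) (p : E) (U : Submodule ℂ (Fin d → ℂ))
    (L : Set (Set E) → Submodule ℂ (Fin d → ℂ)) (hU : Module.finrank ℂ U = rank N)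
    (hLU : ∀ l ∈ subspacesThrough N p, L l ≤ U)
    (hL : ∀ l ∈ subspacesThrough N p, Module.finrank ℂ (L l) = rk N (points l)) :
    expectedDim N p ≤
      Module.finrank ℂ (U ⊓ ⨅ l ∈ subspacesThrough N p, L l : Submodule ℂ (Fin d → ℂ)) := by
  have hfin : (subspacesThrough N p).Finite := Set.toFinite _
  have h := sum_finrank_le_finrank_inf_iInf U L hfin.toFinset
    fun l hl => hLU l (hfin.mem_toFinset.1 hl)
  rw [expectedDim, finsum_mem_eq_finite_toFinset_sum _ hfin, Set.ncard_eq_toFinset_card _ hfin]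
  have h' : ⨅ l ∈ hfin.toFinset, L l = ⨅ l ∈ subspacesThrough N p, L l := by
    simp only [Set.Finite.mem_toFinset]
  rw [hU, h'] at h
  convert! h using 3
  exact congrArg (Nat.cast : ℕ → ℤ) (hL _ (hfin.mem_toFinset.1 ‹_›)).symm

/-- The points of `N` for the index `none`, and the points of a subspace `l` for `some l`: the sets
of points whose spans are constrained in a realization of `N`. -/
def carrier (N : Matroid E) : Option (Set (Set E)) → Set E
  | none => N.E
  | some l => points l

/-- A collection realizes `N` if independent sets stay independent, and if the vectors of the whole
matroid and of each of its subspaces lie in linear spaces of the right dimension. -/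
lemma realizes_of_mem [Finite E] {N : Matroid E} {γ : Collections E d}
    (L : Option (Set (Set E)) → Submodule ℂ (Fin d → ℂ))
    (hind : ∀ I, N.Indep I → LinearIndepOn ℂ γ I)
    (hmem : ∀ k, (∀ l ∈ k, l ∈ subspaces N) → ∀ p ∈ carrier N k, γ p ∈ L k)
    (hdim : ∀ k, (∀ l ∈ k, l ∈ subspaces N) → Module.finrank ℂ (L k) = rk N (carrier N k)) :
    Realizes N γ := by
  refine fun I hI => ⟨hind I, fun hγI => ?_⟩
  by_contra hdep
  obtain ⟨C, hCI, hC⟩ := (Matroid.not_indep_iff hI).1 hdep |>.exists_isCircuit_subset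
  have hγC : LinearIndepOn ℂ γ C := hγI.mono hCI
  have hbound : ∀ k, (∀ l ∈ k, l ∈ subspaces N) → C ⊆ carrier N k →
      C.ncard ≤ rk N (carrier N k) := by
    intro k hk hCk
    rw [← finrank_spanOf_of_linearIndepOn hγC, ← hdim k hk]
    exact Submodule.finrank_mono (spanOf_le.2 fun q hq => hmem k hk q (hCk hq))
  by_cases hsmall : C.ncard < rank N + 1
  · obtain ⟨l, hl, hCl⟩ := exists_subspace_of_smallCircuit (N := N) ⟨hC, hsmall⟩
    have h1 := hbound (some l) (by simpa using hl) fun p hp => ⟨C, hCl, hp⟩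
    have h2 : rk N (points l) = rk N C := subspaceRank_eq N hl hCl
    exact (h1.trans_eq h2).not_gt (rk_circuit_lt_ncard hC)
  · exact hsmall (Nat.lt_succ_of_le (hbound none (by simp) hC.subset_ground))

lemma iInf_option_subspacesThrough (N : Matroid E) (p : E)
    (L : Option (Set (Set E)) → Submodule ℂ (Fin d → ℂ)) :
    ⨅ k : Option (subspacesThrough N p), L (k.map Subtype.val) =
      L none ⊓ ⨅ l ∈ subspacesThrough N p, L (some l) := by
  rw [iInf_option, iInf_subtype']
  rfl

lemma intersectionAt_eq_iInf (N : Matroid E) (γ : Collections E d) (p : E) :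
    intersectionAt N γ p =
      ⨅ k : Option (subspacesThrough N p), spanOf γ (carrier N (k.map Subtype.val)) :=
  (iInf_option_subspacesThrough N p fun k => spanOf γ (carrier N k)).symm

lemma carrier_subset_ground {N : Matroid E} {k : Option (Set (Set E))}
    (hk : ∀ l ∈ k, l ∈ subspaces N) : carrier N k ⊆ N.E := by
  cases k with
  | none => exact subset_rfl
  | some l => exact points_subset_ground (hk l rfl)

lemma mem_subspaces_of_mem_map {N : Matroid E} {p : E} (k : Option (subspacesThrough N p)) :
    ∀ l ∈ k.map Subtype.val, l ∈ subspaces N := by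
  intro l hl
  obtain ⟨l', -, rfl⟩ := Option.mem_map.1 hl
  exact l'.2.1

lemma solvableChain_subset (M : Matroid E) (j : ℕ) :
    (solvableChain M (j + 1)).E ⊆ (solvableChain M j).E := fun _ hp => hp.1

lemma Realizes.solvableChain {M : Matroid E} {γ : Collections E d} (h : Realizes M γ) (j : ℕ) :
    Realizes (solvableChain M j) γ := by
  induction j with
  | zero => exact h
  | succ j ih => exact ih.restrict (solvableChain_subset M j)

end Matroids

section Chain

variable {E : Type*} {d : ℕ}

/-! ### Irreducibility along the solvable chain -/

/-- Given an irreducible set `Z` of collections `z`, copy some vectors of `z` and choose others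
freely in intersections, of constant dimension over `Z`, of spans of independent families of vectors
of `z`. The collections that arise form an irreducible set. -/
lemma isPreirreducible_iUnion_adjoin {I : Type*} [Finite I] [Finite E] {Z : Set (Collections I d)}
    (hZ : IsPreirreducible Z) {R T : Set E} (hRT : Disjoint R T) (φ : E → I) {K : E → Type*}
    [∀ p, Finite (K p)] (S : ∀ p, K p → Set I) (a : E → ℕ)
    (hS : ∀ z ∈ Z, ∀ p ∈ T, ∀ k, LinearIndepOn ℂ z (S p k))
    (ha : ∀ z ∈ Z, ∀ p ∈ T,
      Module.finrank ℂ (⨅ k, spanOf z (S p k) : Submodule ℂ (Fin d → ℂ)) = a p) :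
    IsPreirreducible (⋃ z ∈ Z, {x : Collections E d |
      (∀ p ∈ R, x p = z (φ p)) ∧ ∀ p ∈ T, x p ∈ ⨅ k, spanOf z (S p k)}) := by
  refine isPreirreducible_biUnion_of_sections hZ _ ?_ ?_
  · rintro z x ⟨hxR, hxT⟩ x' ⟨hxR', hxT'⟩ t
    refine ⟨fun p hp => ?_, fun p hp => ?_⟩
    · rw [linePoint, hxR p hp, hxR' p hp, ← add_smul, sub_add_cancel, one_smul]
    · exact Submodule.add_mem _ (Submodule.smul_mem _ _ (hxT p hp))
        (Submodule.smul_mem _ _ (hxT' p hp))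
  · rintro z hz x ⟨hxR, hxT⟩
    have h : ∀ p, ∃ q : Fin d → MvPolynomial (I × Fin d) ℂ, (∀ i, evalAt z (q i) = x p i) ∧
        ∃ O, IsOpen O ∧ z ∈ O ∧ ∀ z' ∈ Z ∩ O,
          (p ∈ R → (fun i => evalAt z' (q i)) = z' (φ p)) ∧
          (p ∈ T → (fun i => evalAt z' (q i)) ∈ ⨅ k, spanOf z' (S p k)) := by
      intro p
      by_cases hpR : p ∈ R
      · refine ⟨fun i => X (φ p, i), fun i => ?_, Set.univ, isOpen_univ, trivial,
          fun z' _ => ⟨fun _ => ?_, fun hpT => (hRT.notMem_of_mem_left hpR hpT).elim⟩⟩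
        · rw [evalAt_X, hxR p hpR]
        · funext i
          rw [evalAt_X]
      by_cases hpT : p ∈ T
      · obtain ⟨q, hq, O, hO, hzO, h⟩ :=
          exists_section_iInf_spanOf (S p) z (hS z hz p hpT) (hxT p hpT)
        refine ⟨q, hq, O, hO, hzO, fun z' hz' => ⟨fun h => (hpR h).elim, fun _ => ?_⟩⟩
        refine h z' hz'.2 (hS z' hz'.1 p hpT) ?_
        rw [ha z hz p hpT, ha z' hz'.1 p hpT]
      · exact ⟨fun i => C (x p i), fun i => evalAt_C _ _, Set.univ, isOpen_univ, trivial,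
          fun z' _ => ⟨fun h => (hpR h).elim, fun h => (hpT h).elim⟩⟩
    choose q hq O hO hzO h using h
    refine ⟨fun z' p i => evalAt z' (q p i), continuous_of_polynomial q fun _ _ _ => rfl, ?_,
      ⋂ p, O p, isOpen_iInter_of_finite hO, Set.mem_iInter.2 hzO, fun z' hz' => ?_⟩
    · funext p i
      exact hq p i
    · have hz'' := fun p => h p z' ⟨hz'.1, Set.mem_iInter.1 hz'.2 p⟩
      exact ⟨fun p hp => (hz'' p).1 hp, fun p hp => (hz'' p).2 hp⟩

lemma spanOf_image {I : Type*} (z : Collections I d) (f : E → I) (S : Set E) :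
    spanOf z (f '' S) = spanOf (fun e => z (f e) : Collections E d) S := by
  refine le_antisymm (spanOf_le.2 ?_)
    (spanOf_le.2 fun q hq => mem_spanOf (Set.mem_image_of_mem f hq))
  rintro _ ⟨q, hq, rfl⟩
  exact mem_spanOf (γ := (fun e => z (f e) : Collections E d)) hq

/-- The inductive step along the solvable chain. A realization of `N` restricts to a realization of
the submatroid on `R = nonpositivePoints N`. To recover it, choose independent copies of the vectors
outside `R` which span, together with the vectors at points of `R`, the space of the whole matroid
and, within it, the space of each subspace; then choose the vector at each point outside `R` in the
intersection of the spaces of the subspaces through it. Quasi-stability keeps the dimensions of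
these intersections constant. -/
lemma isPreirreducible_step [Finite E] {N : Matroid E} {Y : Set (Collections E d)}
    (hY : IsPreirreducible Y) (hreal : ∀ y ∈ Y, Realizes (N.restrict (nonpositivePoints N)) y)
    (hsat : ∀ y ∈ Y, ∀ x : Collections E d, (∀ p ∈ nonpositivePoints N, x p = y p) → x ∈ Y) :
    IsPreirreducible {x | x ∈ Y ∧ Realizes N x ∧ IsQuasiStable N x} := by
  classical
  set R := nonpositivePoints N
  have hRE : R ⊆ N.E := fun p hp => hp.1
  have hβ : ∀ A : Set E, ∃ B, A ⊆ N.E → N.IsBasis B A ∧ N.IsBasis (B ∩ R) (A ∩ R) := by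
    intro A
    by_cases hA : A ⊆ N.E
    · obtain ⟨B, hB⟩ := exists_isBasis_inter N R hA
      exact ⟨B, fun _ => hB⟩
    · exact ⟨∅, fun h => (hA h).elim⟩
  choose β hβ using hβ
  -- The indices of the whole matroid and of its subspaces.
  let valid : Set (Option (Set (Set E))) := {k | ∀ l ∈ k, l ∈ subspaces N}
  let frame : Option (Set (Set E)) → Set (Option (Set (Set E)) × E) :=
    fun k => Prod.mk k '' β (carrier N k)
  have hbasis : ∀ k ∈ valid, N.IsBasis (β (carrier N k)) (carrier N k) :=
    fun k hk => (hβ _ (carrier_subset_ground hk)).1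
  have hnone : none ∈ valid := by simp [valid]
  -- A vector `z (k, e)` for each index `k` and point `e`: a copy of the old vector if `e ∈ R`, an
  -- arbitrary one if `k = none`, and otherwise an arbitrary vector of the space of the whole
  -- matroid. On the open set that follows, the vectors of each frame are a basis of the space for
  -- its index.
  let R' : Set (Option (Set (Set E)) × E) := {a | a.1 = none ∨ a.2 ∈ R}
  have h1 := isPreirreducible_iUnion_adjoin (E := Option (Set (Set E)) × E)
    (hY.inter_isOpen (isOpen_linearIndepOn (β N.E))) (R := R') (T := R'ᶜ) disjoint_compl_right
    Prod.snd (K := fun _ => Unit) (fun _ _ => β N.E) (fun _ => (β N.E).ncard)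
    (fun z hz _ _ _ => hz.2)
    (fun z hz _ _ => by rw [iInf_const]; exact finrank_spanOf_of_linearIndepOn hz.2)
  have h2 := h1.inter_isOpen ((Set.toFinite valid).isOpen_biInter
    fun k _ => isOpen_linearIndepOn (d := d) (frame k))
  have h3 := h2.inter_isOpen ((Set.toFinite (N.E \ R)).isOpen_biInter fun p _ =>
    isOpen_finrank_iInf_spanOf_le (d := d) (K := Option (subspacesThrough N p))
      (fun k => frame (k.map Subtype.val)) (expectedDim N p).toNat)
  set Z := _ ∩ _ ∩ ⋂ p ∈ N.E \ R, _ with hZ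
  have hZmem : ∀ z, z ∈ Z ↔ (∃ y ∈ Y, LinearIndepOn ℂ y (β N.E) ∧ (∀ a ∈ R', z a = y a.2) ∧
      ∀ a ∈ R'ᶜ, z a ∈ spanOf y (β N.E)) ∧ (∀ k ∈ valid, LinearIndepOn ℂ z (frame k)) ∧
      ∀ p ∈ N.E \ R, (∀ k : Option (subspacesThrough N p),
        LinearIndepOn ℂ z (frame (k.map Subtype.val))) ∧
        Module.finrank ℂ (⨅ k : Option (subspacesThrough N p),
          spanOf z (frame (k.map Subtype.val)) : Submodule ℂ (Fin d → ℂ)) ≤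
          (expectedDim N p).toNat := by
    intro z
    simp only [hZ, Set.mem_inter_iff, Set.mem_iUnion, Set.mem_iInter, Set.mem_ofPred_eq,
      iInf_const, exists_prop, and_assoc]
  have hrank : ∀ z ∈ Z, ∀ k ∈ valid,
      Module.finrank ℂ (spanOf z (frame k)) = rk N (carrier N k) := by
    intro z hz k hk
    rw [finrank_spanOf_of_linearIndepOn (((hZmem z).1 hz).2.1 k hk), rk_eq_ncard (hbasis k hk)]
    exact Set.ncard_image_of_injective _ (Prod.mk_right_injective k)
  have hframe : ∀ (z : Collections (Option (Set (Set E)) × E) d) k, ∀ b ∈ β (carrier N k),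
      z (k, b) ∈ spanOf z (frame k) :=
    fun z k b hb => mem_spanOf (Set.mem_image_of_mem _ hb)
  -- The vectors at points of `R` lie in the spaces spanned by the frames.
  have hold : ∀ (z : Collections (Option (Set (Set E)) × E) d), ∀ y ∈ Y,
      (∀ a ∈ R', z a = y a.2) → ∀ k ∈ valid, ∀ p ∈ R, p ∈ carrier N k →
      y p ∈ spanOf z (frame k) := by
    intro z y hy hzy k hk p hp hpk
    have hb := (hβ _ (carrier_subset_ground hk)).2
    have hb' : (N.restrict R).IsBasis (β (carrier N k) ∩ R) (carrier N k ∩ R) :=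
      (Matroid.isBasis_restrict_iff hRE).2 ⟨hb, Set.inter_subset_right⟩
    have hp' : y p ∈ spanOf y (β (carrier N k) ∩ R) := by
      rw [(hreal y hy).spanOf_eq_of_isBasis hb']
      exact mem_spanOf ⟨hpk, hp⟩
    refine spanOf_le.2 (fun b hb => ?_) hp'
    rw [← hzy (k, b) (Or.inr hb.2)]
    exact hframe z k b hb.1
  have hle : ∀ z ∈ Z, ∀ k ∈ valid, spanOf z (frame k) ≤ spanOf z (frame none) := by
    intro z hz k hk
    obtain ⟨⟨y, hy, -, hzy, hzy'⟩, -⟩ := (hZmem z).1 hz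
    refine spanOf_le.2 ?_
    rintro _ ⟨b, hb, rfl⟩
    by_cases hbR : b ∈ R
    · rw [hzy (k, b) (Or.inr hbR)]
      exact hold z y hy hzy none hnone b hbR (hRE hbR)
    cases k with
    | none => exact hframe z none b hb
    | some l =>
      refine spanOf_le.2 (fun c hc => ?_) (hzy' (some l, b) (by simp [R', hbR]))
      rw [← hzy (none, c) (Or.inl rfl)]
      exact hframe z none c hc
  have hdim : ∀ z ∈ Z, ∀ p ∈ N.E \ R, Module.finrank ℂ (⨅ k : Option (subspacesThrough N p),
      spanOf z (frame (k.map Subtype.val)) : Submodule ℂ (Fin d → ℂ)) =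
      (expectedDim N p).toNat := by
    intro z hz p hp
    refine le_antisymm (((hZmem z).1 hz).2.2 p hp).2 (Int.toNat_le.2 ?_)
    rw [iInf_option_subspacesThrough N p fun k => spanOf z (frame k)]
    exact expectedDim_le_finrank N p _ (fun l => spanOf z (frame (some l)))
      (hrank z hz none hnone) (fun l hl => hle z hz _ (by simpa [valid] using hl.1))
      (fun l hl => hrank z hz _ (by simpa [valid] using hl.1))
  have h4 := isPreirreducible_iUnion_adjoin (E := E) h3 (R := R) (T := N.E \ R)
    Set.disjoint_sdiff_right (fun p => (none, p)) (K := fun p => Option (subspacesThrough N p))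
    (fun p k => frame (k.map Subtype.val)) (fun p => (expectedDim N p).toNat)
    (fun z hz p hp => (((hZmem z).1 hz).2.2 p hp).1) hdim
  have h5 := h4.inter_isOpen ((Set.toFinite {I | N.Indep I}).isOpen_biInter
    fun I _ => isOpen_linearIndepOn (d := d) I)
  have hpos : ∀ p ∈ N.E \ R, ((expectedDim N p).toNat : ℤ) = expectedDim N p := by
    intro p hp
    refine Int.toNat_of_nonneg (le_of_lt ?_)
    by_contra! h
    exact hp.2 ⟨hp.1, h⟩
  convert! h5 using 1
  ext x
  simp only [Set.mem_inter_iff, Set.mem_iUnion, Set.mem_iInter, exists_prop, Set.mem_ofPred_eq]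
  constructor
  · rintro ⟨hxY, hxN, hxQ⟩
    -- The copies are taken to be the vectors of `x` themselves.
    let z : Collections (Option (Set (Set E)) × E) d :=
      fun a => if a.1 = none ∨ a.2 ∈ N.E then x a.2 else 0
    have hspan : ∀ k ∈ valid, spanOf z (frame k) = spanOf x (carrier N k) := by
      intro k hk
      rw [← hxN.spanOf_eq_of_isBasis (hbasis k hk), spanOf_image]
      exact spanOf_congr fun q hq => if_pos (Or.inr ((hbasis k hk).indep.subset_ground hq))
    have hind : ∀ k ∈ valid, LinearIndepOn ℂ z (frame k) := by
      intro k hk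
      have hi := (hbasis k hk).indep
      refine LinearIndepOn.image_of_comp (R := ℂ) (Prod.mk k) z ?_
      refine LinearIndepOn.congr (v := x) ((hxN _ hi.subset_ground).1 hi) fun q hq => ?_
      exact (if_pos (Or.inr (hi.subset_ground hq))).symm
    refine ⟨⟨z, (hZmem z).2 ⟨⟨x, hxY, ?_, ?_, ?_⟩, hind, fun p hp => ⟨fun k => ?_, ?_⟩⟩, ?_, ?_⟩,
      ?_⟩
    · have hi := (hbasis none hnone).indep
      exact (hxN _ hi.subset_ground).1 hi
    · rintro a (ha | ha)
      · exact if_pos (Or.inl ha)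
      · exact if_pos (Or.inr (hRE ha))
    · -- Points outside `N` carry no condition; their copies are zero to lie in the required span.
      intro a ha
      by_cases haE : a.2 ∈ N.E
      · rw [show z a = x a.2 from if_pos (Or.inr haE)]
        have := hxN.spanOf_eq_of_isBasis (hbasis none hnone)
        rw [show β N.E = β (carrier N none) from rfl, this]
        exact mem_spanOf haE
      · rw [show z a = 0 from if_neg (not_or.2 ⟨fun h => ha (Or.inl h), haE⟩)]
        exact Submodule.zero_mem _
    · exact hind _ (mem_subspaces_of_mem_map k)
    · rw [iInf_congr fun k => hspan _ (mem_subspaces_of_mem_map k), ← intersectionAt_eq_iInf]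
      have := hxQ p hp.1 hp.2
      omega
    · exact fun p hp => (if_pos (Or.inl rfl)).symm
    · intro p hp
      rw [iInf_congr fun k => hspan _ (mem_subspaces_of_mem_map k), Submodule.mem_iInf]
      intro k
      cases k with
      | none => exact mem_spanOf hp.1
      | some l => exact mem_spanOf l.2.2
    · exact fun I hI => (hxN I hI.subset_ground).1 hI
  · rintro ⟨⟨z, hz, hxR, hxT⟩, hind⟩
    obtain ⟨⟨y, hy, -, hzy, -⟩, -⟩ := (hZmem z).1 hz
    have hxy : ∀ p ∈ R, x p = y p := fun p hp => (hxR p hp).trans (hzy (none, p) (Or.inl rfl))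
    have hmem : ∀ k ∈ valid, ∀ p ∈ carrier N k, x p ∈ spanOf z (frame k) := by
      intro k hk p hpk
      by_cases hp : p ∈ R
      · rw [hxy p hp]
        exact hold z y hy hzy k hk p hp hpk
      have h := (Submodule.mem_iInf _).1 (hxT p ⟨carrier_subset_ground hk hpk, hp⟩)
      cases k with
      | none => exact h none
      | some l => exact h (some ⟨l, hk l rfl, hpk⟩)
    have hxN : Realizes N x :=
      realizes_of_mem (fun k => spanOf z (frame k)) hind hmem fun k hk => hrank z hz k hk
    refine ⟨hsat y hy x hxy, hxN, fun p hp hpR => ?_⟩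
    have hspan : ∀ k ∈ valid, spanOf x (carrier N k) = spanOf z (frame k) := fun k hk =>
      Submodule.eq_of_le_of_finrank_eq (spanOf_le.2 (hmem k hk))
        ((hxN.finrank_spanOf (carrier_subset_ground hk)).trans (hrank z hz k hk).symm)
    rw [intersectionAt_eq_iInf, iInf_congr fun k => hspan _ (mem_subspaces_of_mem_map k),
      hdim z hz p ⟨hp, hpR⟩, hpos p ⟨hp, hpR⟩]

end Chain

section Stable

variable {E : Type*} {d : ℕ}

lemma Realizes.congr {N : Matroid E} {x y : Collections E d} (h : ∀ p ∈ N.E, x p = y p)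
    (hy : Realizes N y) : Realizes N x := by
  intro I hI
  rw [hy I hI]
  exact linearIndepOn_congr fun p hp => (h p (hI hp)).symm

lemma IsQuasiStable.congr {N : Matroid E} {x y : Collections E d} (h : ∀ p ∈ N.E, x p = y p)
    (hy : IsQuasiStable N y) : IsQuasiStable N x := by
  intro p hp hpP
  rw [← hy p hp hpP, intersectionAt_eq_iInf, intersectionAt_eq_iInf,
    iInf_congr fun k => spanOf_congr fun q hq =>
      h q (carrier_subset_ground (mem_subspaces_of_mem_map k) hq)]

lemma solvableChain_antitone (M : Matroid E) : Antitone fun j => (solvableChain M j).E :=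
  antitone_nat_of_succ_le (solvableChain_subset M)

lemma isQuasiStable_of_ground_eq_empty {N : Matroid E} (h : N.E = ∅) (γ : Collections E d) :
    IsQuasiStable N γ := by
  intro p hp
  rw [h] at hp
  exact hp.elim

/-- The stable realizations of a solvable matroid form an irreducible set. -/
lemma isPreirreducible_stableRealizations [Finite E] {M : Matroid E} (hM : IsSolvable M) :
    IsPreirreducible (stableRealizations M) := by
  obtain ⟨J, hJ⟩ := hM
  -- No condition is imposed on the vectors at points outside the `j`-th matroid of the chain.
  let Y : ℕ → Set (Collections E (rank M)) := fun j =>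
    {γ | Realizes (solvableChain M j) γ ∧ ∀ i, j ≤ i → IsQuasiStable (solvableChain M i) γ}
  have hlast : Y J = Set.univ := by
    refine Set.eq_univ_of_forall fun γ => ⟨fun I hI => ?_, fun i hi => ?_⟩
    · obtain rfl := Set.subset_eq_empty hI hJ
      exact iff_of_true (Matroid.empty_indep _) (linearIndepOn_empty ℂ _)
    · exact isQuasiStable_of_ground_eq_empty
        (Set.subset_eq_empty (solvableChain_antitone M hi) hJ) γ
  have hstep : ∀ j, IsPreirreducible (Y (j + 1)) → IsPreirreducible (Y j) := by
    intro j hj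
    convert! isPreirreducible_step (N := solvableChain M j) hj (fun y hy => hy.1) ?_ using 1
    · ext γ
      constructor
      · rintro ⟨h1, h2⟩
        exact ⟨⟨h1.restrict (solvableChain_subset M j), fun i hi => h2 i (by omega)⟩, h1,
          h2 j le_rfl⟩
      · rintro ⟨⟨-, h2⟩, h1, h3⟩
        refine ⟨h1, fun i hi => ?_⟩
        rcases hi.eq_or_lt with rfl | hi
        · exact h3
        · exact h2 i hi
    · intro y hy x hxy
      exact ⟨hy.1.congr hxy, fun i hi =>
        (hy.2 i hi).congr fun p hp => hxy p (solvableChain_antitone M hi hp)⟩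
  have hall : ∀ k ≤ J, IsPreirreducible (Y (J - k)) := by
    intro k
    induction k with
    | zero => exact fun _ => hlast ▸ isPreirreducible_univ_collections
    | succ k ih =>
      intro hk
      refine hstep _ ?_
      rw [show J - (k + 1) + 1 = J - k by omega]
      exact ih (by omega)
  convert! hall J le_rfl using 1
  rw [Nat.sub_self]
  ext γ
  exact and_congr_right fun _ => ⟨fun h i _ => h i, fun h i => h i i.zero_le⟩

/-! ### Openness of the stable locus -/

/-- Among the realizations of `N`, quasi-stability is an open condition: the dimension of each
intersection is at least the expected one, and is upper semicontinuous. -/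
lemma exists_isOpen_iff_isQuasiStable [Finite E] (N : Matroid E) :
    ∃ U : Set (Collections E d), IsOpen U ∧ ∀ γ, Realizes N γ → (γ ∈ U ↔ IsQuasiStable N γ) := by
  have hβ : ∀ A : Set E, ∃ B, A ⊆ N.E → N.IsBasis B A := by
    intro A
    by_cases hA : A ⊆ N.E
    · obtain ⟨B, hB⟩ := N.exists_isBasis A hA
      exact ⟨B, fun _ => hB⟩
    · exact ⟨∅, fun h => (hA h).elim⟩
  choose β hβ using hβ
  refine ⟨_, (Set.toFinite (N.E \ nonpositivePoints N)).isOpen_biInter fun p _ =>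
    isOpen_finrank_iInf_spanOf_le (d := d) (K := Option (subspacesThrough N p))
      (fun k => β (carrier N (k.map Subtype.val))) (expectedDim N p).toNat, fun γ hγ => ?_⟩
  have hb : ∀ p (k : Option (subspacesThrough N p)),
      N.IsBasis (β (carrier N (k.map Subtype.val))) (carrier N (k.map Subtype.val)) :=
    fun p k => hβ _ (carrier_subset_ground (mem_subspaces_of_mem_map k))
  have hind : ∀ p (k : Option (subspacesThrough N p)),
      LinearIndepOn ℂ γ (β (carrier N (k.map Subtype.val))) :=
    fun p k => (hγ _ (hb p k).indep.subset_ground).1 (hb p k).indep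
  have hspan : ∀ p, ⨅ k : Option (subspacesThrough N p),
      spanOf γ (β (carrier N (k.map Subtype.val))) = intersectionAt N γ p := by
    intro p
    rw [intersectionAt_eq_iInf, iInf_congr fun k => hγ.spanOf_eq_of_isBasis (hb p k)]
  simp only [Set.mem_iInter, Set.mem_ofPred_eq]
  have key : ∀ p ∈ N.E \ nonpositivePoints N,
      ((∀ k : Option (subspacesThrough N p),
        LinearIndepOn ℂ γ (β (carrier N (k.map Subtype.val)))) ∧
        Module.finrank ℂ (⨅ k : Option (subspacesThrough N p),
          spanOf γ (β (carrier N (k.map Subtype.val))) : Submodule ℂ (Fin d → ℂ)) ≤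
          (expectedDim N p).toNat ↔
        (Module.finrank ℂ (intersectionAt N γ p) : ℤ) = expectedDim N p) := by
    intro p hp
    have hpos : 0 < expectedDim N p := by
      by_contra! h
      exact hp.2 ⟨hp.1, h⟩
    have hle : expectedDim N p ≤ Module.finrank ℂ (intersectionAt N γ p) :=
      expectedDim_le_finrank N p (spanOf γ N.E) (fun l => spanOf γ (points l))
        (hγ.finrank_spanOf subset_rfl)
        (fun l hl => spanOf_le.2 fun q hq => mem_spanOf (points_subset_ground hl.1 hq))
        (fun l hl => hγ.finrank_spanOf (points_subset_ground hl.1))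
    rw [and_iff_right (hind p), hspan]
    omega
  constructor
  · exact fun h p hp hpP => (key p ⟨hp, hpP⟩).1 (h p ⟨hp, hpP⟩)
  · exact fun h p hp => (key p hp).2 (h p hp.1 hp.2)

/-- The stable realizations of a solvable matroid form an open subset of the matroid variety. -/
lemma exists_isOpen_stableRealizations_eq [Finite E] {M : Matroid E} (hM : IsSolvable M) :
    ∃ U, IsOpen U ∧ stableRealizations M = matroidVariety M ∩ U := by
  obtain ⟨J, hJ⟩ := hM
  choose U hU hUiff using fun j =>
    exists_isOpen_iff_isQuasiStable (d := rank M) (solvableChain M j)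
  refine ⟨_, ((Set.toFinite {I | M.Indep I}).isOpen_biInter fun I _ =>
    isOpen_linearIndepOn (d := rank M) I).inter
    ((Set.finite_lt_nat J).isOpen_biInter fun j _ => hU j), ?_⟩
  ext γ
  simp only [Set.mem_inter_iff, Set.mem_iInter, Set.mem_ofPred_eq]
  constructor
  · rintro ⟨hγ, hst⟩
    refine ⟨subset_closure hγ, fun I hI => (hγ I hI.subset_ground).1 hI, fun j _ => ?_⟩
    exact (hUiff j γ (Realizes.solvableChain hγ j)).2 (hst j)
  · rintro ⟨hγV, hind, hst⟩
    have hγ : Realizes M γ := by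
      refine fun I hI => ⟨hind I, fun hγI => ?_⟩
      -- A dependent set has dependent vectors throughout the variety.
      by_contra hI'
      obtain ⟨γ', hγ'I, hγ'⟩ := mem_closure_iff.1 hγV _ (isOpen_linearIndepOn I) hγI
      exact hI' ((hγ' I hI).2 hγ'I)
    refine ⟨hγ, fun j => ?_⟩
    rcases lt_or_ge j J with hj | hj
    · exact (hUiff j γ (hγ.solvableChain j)).1 (hst j hj)
    · exact isQuasiStable_of_ground_eq_empty
        (Set.subset_eq_empty (solvableChain_antitone M hj) hJ) γ

/-- In a closed subspace `V`, the closure of a nonempty irreducible open subset is an irreducible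
component. -/
lemma exists_mem_irreducibleComponents_image_eq {X : Type*} [TopologicalSpace X] {V S U : Set X}
    (hV : IsClosed V) (hU : IsOpen U) (hSU : S = V ∩ U) (hS : IsIrreducible S) :
    ∃ Z ∈ irreducibleComponents V, Subtype.val '' Z = closure S := by
  have hSV : closure S ⊆ V := closure_minimal (hSU ▸ Set.inter_subset_left) hV
  have himage : ((↑) : V → X) '' (((↑) : V → X) ⁻¹' closure S) = closure S := by
    rw [Subtype.image_preimage_coe, Set.inter_eq_right.2 hSV]
  refine ⟨Subtype.val ⁻¹' closure S, ⟨⟨?_, ?_⟩, fun T hT hle => ?_⟩, himage⟩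
  · obtain ⟨x, hx⟩ := hS.nonempty
    exact ⟨⟨x, hSV (subset_closure hx)⟩, subset_closure hx⟩
  · rintro _ _ ⟨A, hA, rfl⟩ ⟨B, hB, rfl⟩ ⟨a, haS, haA⟩ ⟨b, hbS, hbB⟩
    obtain ⟨c, hcS, hcA, hcB⟩ := hS.isPreirreducible.closure A B hA hB ⟨a, haS, haA⟩ ⟨b, hbS, hbB⟩
    exact ⟨⟨c, hSV hcS⟩, hcS, hcA, hcB⟩
  · have hT' : IsIrreducible (((↑) : V → X) '' T) := hT.image _ continuous_subtype_val.continuousOn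
    obtain ⟨x, hx⟩ := hS.nonempty
    have hxT : x ∈ ((↑) : V → X) '' T :=
      ⟨⟨x, hSV (subset_closure hx)⟩, hle (subset_closure hx), rfl⟩
    have hTS := subset_closure_inter_of_isPreirreducible_of_isOpen hT'.isPreirreducible hU
      ⟨x, hxT, (hSU ▸ hx).2⟩
    refine fun t ht => closure_mono ?_ (hTS ⟨t, ht, rfl⟩)
    rintro _ ⟨⟨y, -, rfl⟩, hyU⟩
    exact hSU ▸ ⟨y.2, hyU⟩

end Stable

end SolvableMatroid

theorem mainTheorem4 {E : Type*} [Finite E] (M : Matroid E) (hE : M.E = Set.univ)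
    (hM : SolvableMatroid.IsSolvable M)
    (hne : (SolvableMatroid.stableRealizations M).Nonempty) :
    ∃ Z ∈ irreducibleComponents (SolvableMatroid.matroidVariety M),
      Subtype.val '' Z = closure (SolvableMatroid.stableRealizations M) := by
  obtain ⟨U, hU, hUeq⟩ := SolvableMatroid.exists_isOpen_stableRealizations_eq hM
  exact SolvableMatroid.exists_mem_irreducibleComponents_image_eq isClosed_closure hU hUeq
    ⟨hne, SolvableMatroid.isPreirreducible_stableRealizations hM⟩
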